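/- **Setting.** Consider $N$ atomic clocks with sampling interval $\tau>0$, and put $$A=\begin{pmatrix}1&\tau\\0&1\end{pmatrix},\quad B=\begin{pmatrix}\tau\\1\end{pmatrix},\quad C=\begin{pmatrix}1&0\end{pmatrix},\quad \mathbf A=A\otimes I_N,\quad \mathbf B=B\otimes I_N.$$ Let $\sigma_{1i}\ge 0$ and $\sigma_{2i}>0$ be the standard deviations of the white frequency noise and the random walk frequency noise of clock $i$, let $\Sigma_j=\operatorname{diag}(\sigma_{j1}^2,\dots,\sigma_{jN}^2)$, and $$\mathbf Q=\begin{pmatrix}\tau\Sigma_1+\frac{\tau^3}{3}\Sigma_2&\frac{\tau^2}{2}\Sigma_2\\ \frac{\tau^2}{2}\Sigma_2&\tau\Sigma_2\end{pmatrix}.$$ Let $V\in\mathbb R^{(N-1)\times N}$ satisfy $\ker V=\operatorname{span}\{\mathbb 1_N\}$ and let $\mathbf R\in\mathbb R^{(N-1)\times(N-1)}$ be positive definite. Let $\mathbf W\in\mathbb R^{2N\times 2(N-1)}$ have full column rank with $\operatorname{im}\mathbf W+\operatorname{im}(I_2\otimes\mathbb 1_N)=\mathbb R^{2N}$, and let $\overline{\mathbf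 W}\in\mathbb R^{2\times 2N}$ have full row rank with $\ker\overline{\mathbf W}=\operatorname{im}\mathbf W$. Put $$\mathbf U=\mathbf W\bigl((I_2\otimes V)\mathbf W\bigr)^{-1},\quad \overline{\mathbf U}=\bigl(\overline{\mathbf W}(I_2\otimes\mathbb 1_N)\bigr)^{-1}\overline{\mathbf W},$$ $$\mathbf A_o=A\otimes I_{N-1},\quad \mathbf B_o=B\otimes I_{N-1},\quad \mathbf C_o=C\otimes I_{N-1},$$ $$\mathbf Q_o=(I_2\otimes V)\mathbf Q(I_2\otimes V)^{\sf T},\quad Q_{\bar o}=\overline{\mathbf U}\mathbf Q(I_2\otimes V)^{\sf T}.$$ The *determinate Kalman filtering algorithm* with input $u$ and measurement $y$, started at a time $k_0\in\mathbb Z$, consists for $k>k_0$ of the covariance and gain equations $$\mathbf P^-_{oo}[k]=\mathbf A_o\mathbf P_{oo}[k-1]\mathbf A_o^{\sf T}+\mathbf Q_o,\qquad P^-_{\bar oo}[k]=\bigl(\overline{\mathbf U}\mathbf A\mathbf U\,\mathbf P_{oo}[k-1]+A P_{\bar oo}[k-1]\bigr)\mathbf A_o^{\sf T}+Q_{\bar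 o},$$ $$\mathbf H_o[k]=\mathbf P^-_{oo}[k]\mathbf C_o^{\sf T}(\mathbf C_o\mathbf P^-_{oo}[k]\mathbf C_o^{\sf T}+\mathbf R)^{-1},\qquad H_{\bar o}[k]=P^-_{\bar oo}[k]\mathbf C_o^{\sf T}(\mathbf C_o\mathbf P^-_{oo}[k]\mathbf C_o^{\sf T}+\mathbf R)^{-1},$$ $$\mathbf P_{oo}[k]=(I-\mathbf H_o[k]\mathbf C_o)\mathbf P^-_{oo}[k],\qquad P_{\bar oo}[k]=P^-_{\bar oo}[k](I-\mathbf C_o^{\sf T}\mathbf H_o[k]^{\sf T}),$$ and of the estimate equations $$\hat\xi^-_o[k]=\mathbf A_o\hat\xi_o[k-1]+\mathbf B_oVu[k-1],\qquad \hat\xi^-_{\bar o}[k]=\overline{\mathbf U}\mathbf A\mathbf U\,\hat\xi_o[k-1]+A\hat\xi_{\bar o}[k-1]+\overline{\mathbf U}\mathbf B u[k-1],$$ $$\hat\xi_o[k]=\hat\xi^-_o[k]+\mathbf H_o[k](y[k]-\mathbf C_o\hat\xi^-_o[k]),\qquad \hat\xi_{\bar o}[k]=\hat\xi^-_{\bar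 o}[k]+H_{\bar o}[k](y[k]-\mathbf C_o\hat\xi^-_o[k]).$$ **Theorem.** There are matrices $\mathbf P^\star_{oo}$, $P^\star_{\bar oo}$, $\mathbf H^\star_o$, $H^\star_{\bar o}$ with the following properties. 1. For every initial time $k_0$, every positive semidefinite $\mathbf P_{oo}[k_0]$ and every $P_{\bar oo}[k_0]$, as $k\to\infty$, $$\mathbf P^-_{oo}[k]\to\mathbf P^\star_{oo},\quad P^-_{\bar oo}[k]\to P^\star_{\bar oo},\quad \mathbf H_o[k]\to\mathbf H^\star_o,\quad H_{\bar o}[k]\to H^\star_{\bar o}.$$ 2. With $\mathbf S(P)=I-\mathbf C_o^{\sf T}(\mathbf C_oP\mathbf C_o^{\sf T}+\mathbf R)^{-1}\mathbf C_oP$, the matrix $\mathbf P^\star_{oo}$ is the unique positive semidefinite solution of $$\mathbf P^\star_{oo}=\mathbf Q_o+\mathbf A_o\mathbf P^\star_{oo}\mathbf S(\mathbf P^\star_{oo})\mathbf A_o^{\sf T},$$ and $P^\star_{\bar oo}$ is the unique solution of $$P^\star_{\bar oo}=Q_{\bar o}+\bigl(AP^\star_{\bar oo}+\overline{\mathbf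 U}\mathbf A\mathbf U\mathbf P^\star_{oo}\bigr)\mathbf S(\mathbf P^\star_{oo})\mathbf A_o^{\sf T}.$$ 3. The stationary gains are $$\mathbf H^\star_o=\mathbf P^\star_{oo}\mathbf C_o^{\sf T}(\mathbf C_o\mathbf P^\star_{oo}\mathbf C_o^{\sf T}+\mathbf R)^{-1},\qquad H^\star_{\bar o}=P^\star_{\bar oo}\mathbf C_o^{\sf T}(\mathbf C_o\mathbf P^\star_{oo}\mathbf C_o^{\sf T}+\mathbf R)^{-1}.$$ 4. The stationary algorithm consists of the four estimate equations above with $\mathbf H_o[k]$, $H_{\bar o}[k]$ replaced by $\mathbf H^\star_o$, $H^\star_{\bar o}$: if a run of the determinate algorithm started at $k_0$ has $\mathbf P^-_{oo}[k_0+1]=\mathbf P^\star_{oo}$ and $P^-_{\bar oo}[k_0+1]=P^\star_{\bar oo}$, then its prior covariances and its gains equal $\mathbf P^\star_{oo},P^\star_{\bar oo},\mathbf H^\star_o,H^\star_{\bar o}$ for all $k>k_0$ and its estimates satisfy the stationary algorithm; conversely, every run of the stationary algorithm consists of the estimates of such a run, with $\mathbf P_{oo}[k_0]$ positive semidefinite.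 5. All eigenvalues of $\mathbf A_o(I-\mathbf H^\star_o\mathbf C_o)\otimes A$ lie in the open unit disk. -/

import Mathlib

open Matrix Filter Topology
open scoped Kronecker

/-- Parameters of an ensemble of `N` second-order atomic clocks with sampling interval `τ`:
`σ₁ i`, `σ₂ i` are the standard deviations of the white frequency noise and of the random walk
frequency noise of clock `i`, `V` is the matrix of measured phase differences, whose kernel
consists exactly of the synchronized vectors, and `R` is the measurement noise covariance. -/
structure ClockEnsemble (N : ℕ) where
  τ : ℝ
  τ_pos : 0 < τ
  σ₁ : Fin N → ℝ
  σ₁_nonneg : ∀ i, 0 ≤ σ₁ i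
  σ₂ : Fin N → ℝ
  σ₂_pos : ∀ i, 0 < σ₂ i
  V : Matrix (Fin (N - 1)) (Fin N) ℝ
  ker_V : LinearMap.ker V.mulVecLin = Submodule.span ℝ {fun _ => (1 : ℝ)}
  R : Matrix (Fin (N - 1)) (Fin (N - 1)) ℝ
  R_posDef : R.PosDef

/-- `I₂ ⊗ 𝟙_N`, as a `2N × 2` matrix. -/
def syncBasis (N : ℕ) : Matrix (Fin 2 × Fin N) (Fin 2) ℝ :=
  ((1 : Matrix (Fin 2) (Fin 2) ℝ) ⊗ₖ (Matrix.of fun _ _ => 1 : Matrix (Fin N) (Fin 1) ℝ)).submatrix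
    id (fun i => (i, 0))

/-- The basis parameter `W` (equivalently `W̄`) of the observable canonical decomposition. -/
structure BasisParameter (N : ℕ) where
  W : Matrix (Fin 2 × Fin N) (Fin 2 × Fin (N - 1)) ℝ
  W_colRank : LinearIndependent ℝ W.col
  range_sup : LinearMap.range W.mulVecLin ⊔ LinearMap.range (syncBasis N).mulVecLin = ⊤
  Wbar : Matrix (Fin 2) (Fin 2 × Fin N) ℝ
  Wbar_rowRank : LinearIndependent ℝ Wbar.row
  ker_Wbar : LinearMap.ker Wbar.mulVecLin = LinearMap.range W.mulVecLin

noncomputable section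

namespace ClockEnsemble

variable {N : ℕ} (E : ClockEnsemble N) (b : BasisParameter N)

/-! ### Single clock matrices -/

def A : Matrix (Fin 2) (Fin 2) ℝ := !![1, E.τ; 0, 1]

def B : Matrix (Fin 2) (Fin 1) ℝ := !![E.τ; 1]

def C : Matrix (Fin 1) (Fin 2) ℝ := !![1, 0]

/-! ### Ensemble matrices -/

/-- `A ⊗ I_N`. -/
def bA : Matrix (Fin 2 × Fin N) (Fin 2 × Fin N) ℝ := E.A ⊗ₖ (1 : Matrix (Fin N) (Fin N) ℝ)

/-- `B ⊗ I_N`. -/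
def bB : Matrix (Fin 2 × Fin N) (Fin N) ℝ :=
  (E.B ⊗ₖ (1 : Matrix (Fin N) (Fin N) ℝ)).submatrix id (fun i => (0, i))

/-- `I₂ ⊗ V`. -/
def bV : Matrix (Fin 2 × Fin (N - 1)) (Fin 2 × Fin N) ℝ :=
  (1 : Matrix (Fin 2) (Fin 2) ℝ) ⊗ₖ E.V

/-- `Σ₁`. -/
def Sig₁ : Matrix (Fin N) (Fin N) ℝ := Matrix.diagonal fun i => E.σ₁ i ^ 2

/-- `Σ₂`. -/
def Sig₂ : Matrix (Fin N) (Fin N) ℝ := Matrix.diagonal fun i => E.σ₂ i ^ 2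

/-- The process noise covariance, a `2 × 2` block matrix with `N × N` blocks. -/
def Q : Matrix (Fin 2 × Fin N) (Fin 2 × Fin N) ℝ :=
  Matrix.comp (Fin 2) (Fin 2) (Fin N) (Fin N) ℝ
    !![E.τ • E.Sig₁ + (E.τ ^ 3 / 3) • E.Sig₂, (E.τ ^ 2 / 2) • E.Sig₂;
       (E.τ ^ 2 / 2) • E.Sig₂, E.τ • E.Sig₂]

/-! ### Observable canonical decomposition -/

/-- `A_o = A ⊗ I_{N-1}`. -/
def Ao : Matrix (Fin 2 × Fin (N - 1)) (Fin 2 × Fin (N - 1)) ℝ :=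
  E.A ⊗ₖ (1 : Matrix (Fin (N - 1)) (Fin (N - 1)) ℝ)

/-- `B_o = B ⊗ I_{N-1}`. -/
def Bo : Matrix (Fin 2 × Fin (N - 1)) (Fin (N - 1)) ℝ :=
  (E.B ⊗ₖ (1 : Matrix (Fin (N - 1)) (Fin (N - 1)) ℝ)).submatrix id (fun i => (0, i))

/-- `C_o = C ⊗ I_{N-1}`. -/
def Co (_E : ClockEnsemble N) : Matrix (Fin (N - 1)) (Fin 2 × Fin (N - 1)) ℝ :=
  (C ⊗ₖ (1 : Matrix (Fin (N - 1)) (Fin (N - 1)) ℝ)).submatrix (fun i => (0, i)) id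

/-- `U = W ((I₂ ⊗ V) W)⁻¹`. -/
def U : Matrix (Fin 2 × Fin N) (Fin 2 × Fin (N - 1)) ℝ := b.W * (E.bV * b.W)⁻¹

/-- `Ū = (W̄ (I₂ ⊗ 𝟙_N))⁻¹ W̄`. -/
def Ubar (_E : ClockEnsemble N) (b : BasisParameter N) : Matrix (Fin 2) (Fin 2 × Fin N) ℝ :=
  (b.Wbar * syncBasis N)⁻¹ * b.Wbar

/-- `Q_o`. -/
def Qo : Matrix (Fin 2 × Fin (N - 1)) (Fin 2 × Fin (N - 1)) ℝ := E.bV * E.Q * E.bVᵀ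

/-- `Q_ō`. -/
def Qu : Matrix (Fin 2) (Fin 2 × Fin (N - 1)) ℝ := E.Ubar b * E.Q * E.bVᵀ

/-- The coupling block `Ū (A ⊗ I_N) U`. -/
def coupling : Matrix (Fin 2) (Fin 2 × Fin (N - 1)) ℝ := E.Ubar b * E.bA * E.U b

/-- `S(P) = I - C_oᵀ (C_o P C_oᵀ + R)⁻¹ C_o P`. -/
def S (P : Matrix (Fin 2 × Fin (N - 1)) (Fin 2 × Fin (N - 1)) ℝ) :
    Matrix (Fin 2 × Fin (N - 1)) (Fin 2 × Fin (N - 1)) ℝ :=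
  1 - E.Coᵀ * (E.Co * P * E.Coᵀ + E.R)⁻¹ * E.Co * P

end ClockEnsemble

/-! ### The determinate Kalman filtering algorithm -/

/-- Sequences of estimates: observable (`o`) and unobservable (`u`) part, prior and posterior. -/
structure KFEstimates (N : ℕ) where
  oPrior : ℤ → Fin 2 × Fin (N - 1) → ℝ
  uPrior : ℤ → Fin 2 → ℝ
  oPost : ℤ → Fin 2 × Fin (N - 1) → ℝ
  uPost : ℤ → Fin 2 → ℝ

/-- Sequences of error covariances (`Poo` for the observable part, `Puo` for the unobservable and
observable parts), prior and posterior, and of Kalman gains. -/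
structure KFCovariances (N : ℕ) where
  PooPrior : ℤ → Matrix (Fin 2 × Fin (N - 1)) (Fin 2 × Fin (N - 1)) ℝ
  PuoPrior : ℤ → Matrix (Fin 2) (Fin 2 × Fin (N - 1)) ℝ
  Ho : ℤ → Matrix (Fin 2 × Fin (N - 1)) (Fin (N - 1)) ℝ
  Hu : ℤ → Matrix (Fin 2) (Fin (N - 1)) ℝ
  PooPost : ℤ → Matrix (Fin 2 × Fin (N - 1)) (Fin 2 × Fin (N - 1)) ℝ
  PuoPost : ℤ → Matrix (Fin 2) (Fin 2 × Fin (N - 1)) ℝ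

namespace ClockEnsemble

variable {N : ℕ} (E : ClockEnsemble N) (b : BasisParameter N)

/-- Covariance and gain equations of the determinate algorithm, started at time `k₀` with the
posterior covariances `PooPost k₀`, `PuoPost k₀`. -/
structure CovarianceEquations (k₀ : ℤ) (c : KFCovariances N) : Prop where
  PooPrior_eq : ∀ k > k₀, c.PooPrior k = E.Ao * c.PooPost (k - 1) * E.Aoᵀ + E.Qo
  PuoPrior_eq : ∀ k > k₀, c.PuoPrior k =
    (E.coupling b * c.PooPost (k - 1) + E.A * c.PuoPost (k - 1)) * E.Aoᵀ + E.Qu b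
  Ho_eq : ∀ k > k₀, c.Ho k =
    c.PooPrior k * E.Coᵀ * (E.Co * c.PooPrior k * E.Coᵀ + E.R)⁻¹
  Hu_eq : ∀ k > k₀, c.Hu k =
    c.PuoPrior k * E.Coᵀ * (E.Co * c.PooPrior k * E.Coᵀ + E.R)⁻¹
  PooPost_eq : ∀ k > k₀, c.PooPost k = (1 - c.Ho k * E.Co) * c.PooPrior k
  PuoPost_eq : ∀ k > k₀, c.PuoPost k = c.PuoPrior k * (1 - E.Coᵀ * (c.Ho k)ᵀ)

/-- State estimate equations with input `u`, measurement `y` and gain sequences `Ho`, `Hu`,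
started at time `k₀` with the posterior estimates `oPost k₀`, `uPost k₀`. -/
structure EstimateEquations (k₀ : ℤ) (u : ℤ → Fin N → ℝ) (y : ℤ → Fin (N - 1) → ℝ)
    (Ho : ℤ → Matrix (Fin 2 × Fin (N - 1)) (Fin (N - 1)) ℝ)
    (Hu : ℤ → Matrix (Fin 2) (Fin (N - 1)) ℝ) (e : KFEstimates N) : Prop where
  oPrior_eq : ∀ k > k₀, e.oPrior k =
    E.Ao *ᵥ e.oPost (k - 1) + (E.Bo * E.V) *ᵥ u (k - 1)
  uPrior_eq : ∀ k > k₀, e.uPrior k =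
    E.coupling b *ᵥ e.oPost (k - 1) + E.A *ᵥ e.uPost (k - 1) + (E.Ubar b * E.bB) *ᵥ u (k - 1)
  oPost_eq : ∀ k > k₀, e.oPost k = e.oPrior k + Ho k *ᵥ (y k - E.Co *ᵥ e.oPrior k)
  uPost_eq : ∀ k > k₀, e.uPost k = e.uPrior k + Hu k *ᵥ (y k - E.Co *ᵥ e.oPrior k)

/-- A run, started at time `k₀`, of the determinate Kalman filtering algorithm. -/
structure IsDeterminateKF (k₀ : ℤ) (u : ℤ → Fin N → ℝ) (y : ℤ → Fin (N - 1) → ℝ)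
    (c : KFCovariances N) (e : KFEstimates N) : Prop where
  cov : E.CovarianceEquations b k₀ c
  est : E.EstimateEquations b k₀ u y c.Ho c.Hu e

/-- A run, started at time `k₀`, of the filter with constant gains `Hos`, `Hus`. -/
def IsStationaryKF (k₀ : ℤ) (u : ℤ → Fin N → ℝ) (y : ℤ → Fin (N - 1) → ℝ)
    (Hos : Matrix (Fin 2 × Fin (N - 1)) (Fin (N - 1)) ℝ)
    (Hus : Matrix (Fin 2) (Fin (N - 1)) ℝ) (e : KFEstimates N) : Prop :=
  E.EstimateEquations b k₀ u y (fun _ => Hos) (fun _ => Hus) e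

end ClockEnsemble

end

/-! Everything rests on `Qo` being positive definite: the random walk noise makes `Q` positive
definite, and `V` has full row rank.

The posterior covariance is the minimum, in the Loewner order, of the Joseph forms over all gains,
and each Joseph form is monotone and affine in `P` (`josephForm_eq`). Hence the Riccati map is
monotone, and scaling `P` by `t` leaves a surplus proportional to `Q` (`riccati_smul_le`,
`smul_riccati_le`). A deadbeat gain yields a supersolution, from which the iterates decrease to a
fixed point (`exists_riccati_eq`). If `P ≤ c • Q` at the fixed point, the surplus squeezes every
orbit between multiples of `P` whose factors tend to 1 at rate `1 - c⁻¹` (`tendsto_riccati`);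
uniqueness follows.

For the unobservable block, the prior covariances serve as a time-varying Lyapunov function for the
closed loop `F = A (I - H C)`: `F p Fᵀ` is at most the next covariance minus `Q`, hence at most a
fixed fraction of it (`tendsto_zero_of_closedLoop`). As the clock matrix is unipotent triangular, `X
↦ A X Fᵀ` is a cascade of two such loops and is stable as well. This gives convergence of the cross
covariance, unique solvability of its stationary equation, and the spectral bound. -/

set_option linter.unusedSectionVars false

noncomputable section

namespace KalmanFilter

open scoped MatrixOrder

variable {n m : Type*} [Fintype n] [DecidableEq n] [Fintype m] [DecidableEq m]

/-! ### Loewner order and quadratic forms of real matrices -/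

theorem isHermitian_iff_transpose_eq {M : Matrix n n ℝ} : M.IsHermitian ↔ Mᵀ = M := by
  rw [Matrix.IsHermitian, conjTranspose_eq_transpose_of_trivial]

theorem posSemidef_iff_transpose_eq {M : Matrix n n ℝ} :
    M.PosSemidef ↔ Mᵀ = M ∧ ∀ x, 0 ≤ x ⬝ᵥ M *ᵥ x := by
  rw [posSemidef_iff_dotProduct_mulVec, isHermitian_iff_transpose_eq]
  simp

theorem _root_.Matrix.PosSemidef.transpose_eq {M : Matrix n n ℝ} (hM : M.PosSemidef) : Mᵀ = M :=
  (posSemidef_iff_transpose_eq.1 hM).1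

theorem dotProduct_mulVec_mono {M M' : Matrix n n ℝ} (h : M ≤ M') (x : n → ℝ) :
    x ⬝ᵥ M *ᵥ x ≤ x ⬝ᵥ M' *ᵥ x := by
  have := (posSemidef_iff_transpose_eq.1 (le_iff.1 h)).2 x
  rw [sub_mulVec, dotProduct_sub] at this
  linarith

theorem le_of_dotProduct_mulVec_le {M M' : Matrix n n ℝ} (hM : Mᵀ = M) (hM' : M'ᵀ = M')
    (h : ∀ x, x ⬝ᵥ M *ᵥ x ≤ x ⬝ᵥ M' *ᵥ x) : M ≤ M' := by
  rw [le_iff, posSemidef_iff_transpose_eq]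
  refine ⟨by rw [transpose_sub, hM, hM'], fun x => ?_⟩
  rw [sub_mulVec, dotProduct_sub]
  linarith [h x]

theorem mul_mul_transpose_mono {M M' : Matrix n n ℝ} (h : M ≤ M') (L : Matrix m n ℝ) :
    L * M * Lᵀ ≤ L * M' * Lᵀ := by
  have := (le_iff.1 h).mul_mul_conjTranspose_same L
  rw [conjTranspose_eq_transpose_of_trivial] at this
  rw [le_iff]
  rwa [Matrix.mul_sub, Matrix.sub_mul] at this

theorem posSemidef_mul_mul_transpose {M : Matrix n n ℝ} (h : M.PosSemidef) (L : Matrix m n ℝ) :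
    (L * M * Lᵀ).PosSemidef := by
  simpa [conjTranspose_eq_transpose_of_trivial] using h.mul_mul_conjTranspose_same L

theorem smul_le_smul_left {M M' : Matrix n n ℝ} (h : M ≤ M') {t : ℝ} (ht : 0 ≤ t) :
    t • M ≤ t • M' := by
  have := (le_iff.1 h).smul ht
  rw [le_iff]
  rwa [smul_sub] at this

theorem smul_le_smul_right {M : Matrix n n ℝ} (hM : M.PosSemidef) {s t : ℝ} (h : s ≤ t) :
    s • M ≤ t • M := by
  have := hM.smul (sub_nonneg.2 h)
  rw [le_iff]
  rwa [sub_smul] at this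

theorem posSemidef_of_le {M M' : Matrix n n ℝ} (hM : M.PosSemidef) (h : M ≤ M') :
    M'.PosSemidef :=
  nonneg_iff_posSemidef.1 ((nonneg_iff_posSemidef.2 hM).trans h)

theorem posDef_of_le {M M' : Matrix n n ℝ} (hM : M.PosDef) (h : M ≤ M') : M'.PosDef := by
  have := hM.add_posSemidef (le_iff.1 h)
  rwa [add_sub_cancel] at this

/-- The ratio of the two quadratic forms is bounded on the compact unit sphere and invariant under
scaling. The bound `1 ≤ c` is included because the scaling inequalities need factors on a known side
of 1. -/
theorem exists_le_smul {M Q : Matrix n n ℝ} (hM : M.PosSemidef) (hQ : Q.PosDef) :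
    ∃ c : ℝ, 1 ≤ c ∧ M ≤ c • Q := by
  have hpos : ∀ x : n → ℝ, x ≠ 0 → 0 < x ⬝ᵥ Q *ᵥ x := fun x hx => by
    simpa using hQ.dotProduct_mulVec_pos hx
  have hcont : ∀ P : Matrix n n ℝ, Continuous fun x : n → ℝ => x ⬝ᵥ P *ᵥ x := fun P => by
    fun_prop
  obtain ⟨c, hc⟩ := (isCompact_sphere (0 : n → ℝ) 1).exists_bound_of_continuousOn
    (f := fun x => (x ⬝ᵥ M *ᵥ x) / (x ⬝ᵥ Q *ᵥ x))
    ((hcont M).continuousOn.div (hcont Q).continuousOn fun x hx =>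
      (hpos x (by rintro rfl; simp at hx)).ne')
  refine ⟨max c 1, le_max_right _ _, le_of_dotProduct_mulVec_le hM.transpose_eq
    (by rw [transpose_smul, hQ.posSemidef.transpose_eq]) fun x => ?_⟩
  by_cases hx : x = 0
  · simp [hx]
  have hn : ‖x‖ ≠ 0 := norm_ne_zero_iff.2 hx
  have h1 := hc (‖x‖⁻¹ • x) (by simp [norm_smul, hn])
  simp only [mulVec_smul, dotProduct_smul, smul_dotProduct, smul_eq_mul] at h1
  rw [mul_div_mul_left _ _ (inv_ne_zero hn), mul_div_mul_left _ _ (inv_ne_zero hn)] at h1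
  have h2 := (le_abs_self _).trans (h1.trans (le_max_left c 1))
  rw [div_le_iff₀ (hpos x hx)] at h2
  simpa [smul_mulVec] using h2

/-- Polarization: it reduces convergence of symmetric matrices to convergence of their quadratic
forms. -/
theorem apply_eq_dotProduct_mulVec {M : Matrix n n ℝ} (hM : Mᵀ = M) (i j : n) :
    M i j = ((Pi.single i 1 + Pi.single j 1) ⬝ᵥ M *ᵥ (Pi.single i 1 + Pi.single j 1)
      - Pi.single i 1 ⬝ᵥ M *ᵥ Pi.single i 1 - Pi.single j 1 ⬝ᵥ M *ᵥ Pi.single j 1) / 2 := by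
  have : M j i = M i j := congr_fun (congr_fun hM i) j
  simp only [mulVec_add, add_dotProduct, dotProduct_add, mulVec_single_one, single_one_dotProduct,
    col_apply, this]
  ring

theorem tendsto_of_dotProduct_mulVec {M : ℕ → Matrix n n ℝ} {M' : Matrix n n ℝ}
    (hM : ∀ k, (M k)ᵀ = M k) (hM' : M'ᵀ = M')
    (h : ∀ x, Tendsto (fun k => x ⬝ᵥ M k *ᵥ x) atTop (𝓝 (x ⬝ᵥ M' *ᵥ x))) :
    Tendsto M atTop (𝓝 M') := by
  refine tendsto_pi_nhds.2 fun i => tendsto_pi_nhds.2 fun j => ?_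
  rw [apply_eq_dotProduct_mulVec hM']
  simp_rw [fun k => apply_eq_dotProduct_mulVec (hM k) i j]
  exact (((h _).sub (h _)).sub (h _)).div_const 2

theorem isClosed_posSemidef : IsClosed {M : Matrix n n ℝ | M.PosSemidef} := by
  simp_rw [posSemidef_iff_transpose_eq, Set.ofPred_and, Set.ofPred_forall]
  refine (isClosed_eq (by fun_prop) (by fun_prop)).inter (isClosed_iInter fun x =>
    isClosed_le (by fun_prop) (by fun_prop))

/-- A decreasing sequence of positive semidefinite matrices converges. -/
theorem exists_tendsto_of_antitone {M : ℕ → Matrix n n ℝ} (hM : ∀ k, (M k).PosSemidef)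
    (hanti : ∀ k, M (k + 1) ≤ M k) : ∃ M', M'.PosSemidef ∧ Tendsto M atTop (𝓝 M') := by
  have h : ∀ x : n → ℝ, ∃ l, Tendsto (fun k => x ⬝ᵥ M k *ᵥ x) atTop (𝓝 l) := fun x =>
    ⟨_, tendsto_atTop_ciInf (antitone_nat_of_succ_le fun k => dotProduct_mulVec_mono (hanti k) x)
      ⟨0, by rintro _ ⟨k, rfl⟩; exact (posSemidef_iff_transpose_eq.1 (hM k)).2 x⟩⟩
  choose q hq using h
  have key : Tendsto M atTop (𝓝 (Matrix.of fun i j =>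
      (q (Pi.single i 1 + Pi.single j 1) - q (Pi.single i 1) - q (Pi.single j 1)) / 2)) := by
    refine tendsto_pi_nhds.2 fun i => tendsto_pi_nhds.2 fun j => ?_
    simp_rw [fun k => apply_eq_dotProduct_mulVec (hM k).transpose_eq i j]
    exact (((hq _).sub (hq _)).sub (hq _)).div_const 2
  exact ⟨_, isClosed_posSemidef.mem_of_tendsto key (Eventually.of_forall hM), key⟩

theorem _root_.Filter.Tendsto.matrix_mul {α l : Type*} {F : Filter α} {f : α → Matrix l n ℝ}
    {g : α → Matrix n m ℝ} {X : Matrix l n ℝ} {Y : Matrix n m ℝ} (hf : Tendsto f F (𝓝 X))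
    (hg : Tendsto g F (𝓝 Y)) : Tendsto (fun a => f a * g a) F (𝓝 (X * Y)) :=
  ((continuous_fst.matrix_mul continuous_snd).tendsto (X, Y)).comp (hf.prodMk_nhds hg)

/-! ### The measurement update -/

/-- The Kalman gain `P Cᵀ (C P Cᵀ + R)⁻¹` for the prior covariance `P`. -/
def gain (C : Matrix m n ℝ) (R : Matrix m m ℝ) (P : Matrix n n ℝ) : Matrix n m ℝ :=
  P * Cᵀ * (C * P * Cᵀ + R)⁻¹

/-- The posterior covariance for the prior covariance `P`. -/
def posterior (C : Matrix m n ℝ) (R : Matrix m m ℝ) (P : Matrix n n ℝ) : Matrix n n ℝ :=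
  (1 - gain C R P * C) * P

/-- The posterior covariance obtained with an arbitrary gain `K`. -/
def josephForm (C : Matrix m n ℝ) (R : Matrix m m ℝ) (P : Matrix n n ℝ) (K : Matrix n m ℝ) :
    Matrix n n ℝ :=
  (1 - K * C) * P * (1 - K * C)ᵀ + K * R * Kᵀ

variable {C : Matrix m n ℝ} {R : Matrix m m ℝ} {P P' : Matrix n n ℝ}

theorem posDef_innovation (hR : R.PosDef) (hP : P.PosSemidef) : (C * P * Cᵀ + R).PosDef :=
  hR.posSemidef_add (posSemidef_mul_mul_transpose hP C)

/-- Completing the square in `K`. The remainder is positive semidefinite and vanishes at the Kalman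
gain, so that gain is optimal. -/
theorem josephForm_eq (hR : R.PosDef) (hP : P.PosSemidef) (K : Matrix n m ℝ) :
    josephForm C R P K = posterior C R P
      + (K - gain C R P) * (C * P * Cᵀ + R) * (K - gain C R P)ᵀ := by
  have hS := posDef_innovation (C := C) hR hP
  have hu : IsUnit (C * P * Cᵀ + R).det := (isUnit_iff_isUnit_det _).1 hS.isUnit
  have hTt : ((C * P * Cᵀ + R)⁻¹)ᵀ = (C * P * Cᵀ + R)⁻¹ := hS.inv.posSemidef.transpose_eq
  have hHt : (gain C R P)ᵀ = (C * P * Cᵀ + R)⁻¹ * (C * P) := by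
    rw [gain, transpose_mul, hTt, transpose_mul, transpose_transpose, hP.transpose_eq]
  have hHS : gain C R P * (C * P * Cᵀ + R) = P * Cᵀ := by
    rw [gain, Matrix.mul_assoc, nonsing_inv_mul _ hu, Matrix.mul_one]
  have hSH : (C * P * Cᵀ + R) * (gain C R P)ᵀ = C * P := by
    rw [hHt, mul_nonsing_inv_cancel_left _ _ hu]
  have e1 : (K - gain C R P) * (C * P * Cᵀ + R) * (K - gain C R P)ᵀ =
      K * (C * P * Cᵀ + R) * Kᵀ - K * (C * P) - P * Cᵀ * Kᵀ + gain C R P * (C * P) := by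
    rw [transpose_sub, Matrix.sub_mul, hHS, Matrix.mul_sub, Matrix.sub_mul, Matrix.sub_mul,
      Matrix.mul_assoc K _ (gain C R P)ᵀ, hSH, hHt, gain]
    simp only [Matrix.mul_assoc]
    abel
  rw [e1, josephForm, posterior]
  simp only [transpose_sub, transpose_one, transpose_mul, Matrix.mul_sub, Matrix.sub_mul,
    Matrix.mul_add, Matrix.add_mul, Matrix.one_mul, Matrix.mul_one, Matrix.mul_assoc]
  abel

theorem posterior_le_josephForm (hR : R.PosDef) (hP : P.PosSemidef) (K : Matrix n m ℝ) :
    posterior C R P ≤ josephForm C R P K := by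
  rw [josephForm_eq hR hP]
  exact le_add_of_nonneg_right (nonneg_iff_posSemidef.2
    (posSemidef_mul_mul_transpose (posDef_innovation hR hP).posSemidef _))

theorem josephForm_gain (hR : R.PosDef) (hP : P.PosSemidef) :
    josephForm C R P (gain C R P) = posterior C R P := by
  rw [josephForm_eq hR hP]
  simp

theorem posSemidef_posterior (hR : R.PosDef) (hP : P.PosSemidef) :
    (posterior C R P).PosSemidef := by
  rw [← josephForm_gain hR hP]
  exact (posSemidef_mul_mul_transpose hP _).add (posSemidef_mul_mul_transpose hR.posSemidef _)

theorem josephForm_mono (h : P ≤ P') (K : Matrix n m ℝ) :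
    josephForm C R P K ≤ josephForm C R P' K :=
  add_le_add_left (mul_mul_transpose_mono h _) _

/-- The gain optimal for `P'` is admissible, though suboptimal, for `P`. -/
theorem posterior_mono (hR : R.PosDef) (hP : P.PosSemidef) (h : P ≤ P') :
    posterior C R P ≤ posterior C R P' := by
  rw [← josephForm_gain hR (posSemidef_of_le hP h)]
  exact (posterior_le_josephForm hR hP _).trans (josephForm_mono h _)

/-- The gain of `P` is tried on `t • P`: only the covariance term of the Joseph form scales, and the
noise term is at most `t` times itself. -/
theorem posterior_smul_le (hR : R.PosDef) (hP : P.PosSemidef) {t : ℝ} (ht : 1 ≤ t) :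
    posterior C R (t • P) ≤ t • posterior C R P := by
  refine (posterior_le_josephForm hR (hP.smul (by linarith)) (gain C R P)).trans ?_
  rw [← josephForm_gain hR hP, josephForm, josephForm, smul_add, Matrix.mul_smul, Matrix.smul_mul]
  refine add_le_add_right ?_ _
  have := smul_le_smul_right (posSemidef_mul_mul_transpose hR.posSemidef (gain C R P)) ht
  rwa [one_smul] at this

theorem smul_posterior_le (hR : R.PosDef) (hP : P.PosSemidef) {t : ℝ} (h0 : 0 ≤ t) (ht : t ≤ 1) :
    t • posterior C R P ≤ posterior C R (t • P) := by
  refine (smul_le_smul_left (posterior_le_josephForm hR hP (gain C R (t • P))) h0).trans ?_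
  rw [← josephForm_gain hR (hP.smul h0), josephForm, josephForm, smul_add, Matrix.mul_smul,
    Matrix.smul_mul]
  refine add_le_add_right ?_ _
  have := smul_le_smul_right (posSemidef_mul_mul_transpose hR.posSemidef (gain C R (t • P))) ht
  rwa [one_smul] at this

theorem continuousAt_innovation_inv (hR : R.PosDef) (hP : P.PosSemidef) :
    ContinuousAt (fun X : Matrix n n ℝ => (C * X * Cᵀ + R)⁻¹) P := by
  have hu : IsUnit (C * P * Cᵀ + R).det :=
    (isUnit_iff_isUnit_det _).1 (posDef_innovation hR hP).isUnit
  refine (continuousAt_matrix_inv _ ?_).comp (f := fun X : Matrix n n ℝ => C * X * Cᵀ + R)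
    (by fun_prop)
  rw [Ring.inverse_eq_inv']
  exact continuousAt_inv₀ hu.ne_zero

theorem continuousAt_gain (hR : R.PosDef) (hP : P.PosSemidef) : ContinuousAt (gain C R) P := by
  have h : ContinuousAt (fun X : Matrix n n ℝ => X * Cᵀ) P := by fun_prop
  exact h.tendsto.matrix_mul (continuousAt_innovation_inv hR hP).tendsto

/-! ### The Riccati map -/

/-- One step of the prior covariance recursion. -/
def riccati (A : Matrix n n ℝ) (C : Matrix m n ℝ) (Q : Matrix n n ℝ) (R : Matrix m m ℝ)
    (P : Matrix n n ℝ) : Matrix n n ℝ :=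
  A * posterior C R P * Aᵀ + Q

/-- The closed loop matrix `A (I - H C)` of the prior estimation error. -/
def closedLoop (A : Matrix n n ℝ) (C : Matrix m n ℝ) (R : Matrix m m ℝ) (P : Matrix n n ℝ) :
    Matrix n n ℝ :=
  A * (1 - gain C R P * C)

variable {A Q : Matrix n n ℝ}

theorem le_riccati (hR : R.PosDef) (hP : P.PosSemidef) : Q ≤ riccati A C Q R P :=
  le_add_of_nonneg_left (nonneg_iff_posSemidef.2
    (posSemidef_mul_mul_transpose (posSemidef_posterior hR hP) _))

theorem posDef_riccati (hQ : Q.PosDef) (hR : R.PosDef) (hP : P.PosSemidef) :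
    (riccati A C Q R P).PosDef :=
  posDef_of_le hQ (le_riccati hR hP)

theorem riccati_mono (hR : R.PosDef) (hP : P.PosSemidef) (h : P ≤ P') :
    riccati A C Q R P ≤ riccati A C Q R P' :=
  add_le_add_left (mul_mul_transpose_mono (posterior_mono hR hP h) _) _

/-- The additive `Q` does not scale with `P`; the resulting gain of `(t - 1) • Q` is what makes the
recursion contract. -/
theorem riccati_smul_le (hR : R.PosDef) (hP : P.PosSemidef) {t : ℝ} (ht : 1 ≤ t) :
    riccati A C Q R (t • P) ≤ t • riccati A C Q R P - (t - 1) • Q := by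
  have := add_le_add_left (mul_mul_transpose_mono (posterior_smul_le (C := C) hR hP ht) A) Q
  rw [riccati, riccati]
  convert this using 1
  rw [Matrix.mul_smul, Matrix.smul_mul]
  module

theorem smul_riccati_le (hR : R.PosDef) (hP : P.PosSemidef) {t : ℝ} (h0 : 0 ≤ t) (ht : t ≤ 1) :
    t • riccati A C Q R P + (1 - t) • Q ≤ riccati A C Q R (t • P) := by
  have := add_le_add_left (mul_mul_transpose_mono (smul_posterior_le (C := C) hR hP h0 ht) A) Q
  rw [riccati, riccati]
  convert this using 1
  rw [Matrix.mul_smul, Matrix.smul_mul]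
  module

/-- The Joseph form at the optimal gain with its measurement noise term dropped; this is the
Lyapunov inequality behind closed-loop stability. -/
theorem closedLoop_mul_mul_transpose_le (hR : R.PosDef) (hP : P.PosSemidef) :
    closedLoop A C R P * P * (closedLoop A C R P)ᵀ ≤ riccati A C Q R P - Q := by
  have : (1 - gain C R P * C) * P * (1 - gain C R P * C)ᵀ ≤ posterior C R P := by
    rw [← josephForm_gain hR hP]
    exact le_add_of_nonneg_right (nonneg_iff_posSemidef.2
      (posSemidef_mul_mul_transpose hR.posSemidef _))
  have := mul_mul_transpose_mono this A
  rw [riccati, add_sub_cancel_right, closedLoop, transpose_mul]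
  simpa only [Matrix.mul_assoc] using this

theorem continuousAt_riccati (hR : R.PosDef) (hP : P.PosSemidef) :
    ContinuousAt (riccati A C Q R) P := by
  have := continuousAt_gain (C := C) hR hP
  unfold riccati posterior
  have h2 : ContinuousAt (fun X : Matrix n n ℝ => (1 - gain C R X * C) * X) P :=
    (tendsto_const_nhds.sub (this.tendsto.matrix_mul tendsto_const_nhds)).matrix_mul tendsto_id
  exact ((tendsto_const_nhds.matrix_mul h2.tendsto).matrix_mul tendsto_const_nhds).add
    tendsto_const_nhds

/-! ### Existence, attractivity and uniqueness of the Riccati fixed point -/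

/-- A gain that annihilates the estimation error in two steps provides a supersolution of the
Riccati equation. -/
theorem exists_riccati_le (hQ : Q.PosDef) (hR : R.PosDef) (K : Matrix n m ℝ)
    (hK : A * (1 - K * C) * (A * (1 - K * C)) = 0) :
    ∃ M : Matrix n n ℝ, M.PosSemidef ∧ riccati A C Q R M ≤ M := by
  set L := A * (1 - K * C) with hL
  -- With the fixed gain `K` the recursion is `M ↦ L M Lᵀ + M₀`. Its fixed point is the series of
  -- the `Lⁱ M₀ (Lⁱ)ᵀ`, which stops after two terms because `L * L = 0`.
  set M₀ := A * (K * R * Kᵀ) * Aᵀ + Q with hM₀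
  have h0 : M₀.PosSemidef := (posSemidef_mul_mul_transpose
    (posSemidef_mul_mul_transpose hR.posSemidef _) _).add hQ.posSemidef
  have hM : (M₀ + L * M₀ * Lᵀ).PosSemidef := h0.add (posSemidef_mul_mul_transpose h0 L)
  refine ⟨M₀ + L * M₀ * Lᵀ, hM, ?_⟩
  have := add_le_add_left (mul_mul_transpose_mono (posterior_le_josephForm (C := C) hR hM K) A) Q
  refine this.trans (le_of_eq ?_)
  have e : A * josephForm C R (M₀ + L * M₀ * Lᵀ) K * Aᵀ + Q
      = L * (M₀ + L * M₀ * Lᵀ) * Lᵀ + M₀ := by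
    rw [josephForm, hL, hM₀, transpose_mul A]
    simp only [Matrix.mul_add, Matrix.add_mul, Matrix.mul_assoc]
    abel
  rw [e, Matrix.mul_add, Matrix.add_mul, ← Matrix.mul_assoc L (L * M₀), ← Matrix.mul_assoc L L, hK]
  simp [add_comm]

theorem exists_riccati_eq (hQ : Q.PosDef) (hR : R.PosDef)
    (h : ∃ M : Matrix n n ℝ, M.PosSemidef ∧ riccati A C Q R M ≤ M) :
    ∃ P : Matrix n n ℝ, P.PosSemidef ∧ riccati A C Q R P = P := by
  obtain ⟨M, hM, hle⟩ := h
  have hpos : ∀ k, ((riccati A C Q R)^[k] M).PosSemidef := fun k => by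
    induction k with
    | zero => exact hM
    | succ k ih => rw [Function.iterate_succ_apply']; exact (posDef_riccati hQ hR ih).posSemidef
  have hanti : ∀ k, (riccati A C Q R)^[k + 1] M ≤ (riccati A C Q R)^[k] M := fun k => by
    induction k with
    | zero => exact hle
    | succ k ih =>
      rw [Function.iterate_succ_apply' _ k, Function.iterate_succ_apply' _ (k + 1)]
      exact riccati_mono hR (hpos _) ih
  obtain ⟨P, hP, hlim⟩ := exists_tendsto_of_antitone hpos hanti
  refine ⟨P, hP, tendsto_nhds_unique ?_ ((tendsto_add_atTop_iff_nat 1).2 hlim)⟩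
  simp_rw [Function.iterate_succ_apply']
  exact (continuousAt_riccati hR hP).tendsto.comp hlim

/-- The Riccati recursion converges to any positive semidefinite fixed point, from any positive
semidefinite initial value. -/
theorem tendsto_riccati (hQ : Q.PosDef) (hR : R.PosDef) (hP : P.PosSemidef)
    (hfix : riccati A C Q R P = P) {p : ℕ → Matrix n n ℝ} (h0 : (p 0).PosSemidef)
    (hp : ∀ k, p (k + 1) = riccati A C Q R (p k)) : Tendsto p atTop (𝓝 P) := by
  have hPd : P.PosDef := hfix ▸ posDef_riccati hQ hR hP
  have hpos : ∀ k, (p k).PosSemidef := fun k => by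
    induction k with
    | zero => exact h0
    | succ k ih => rw [hp]; exact (posDef_riccati hQ hR ih).posSemidef
  obtain ⟨c, hc1, hc⟩ := exists_le_smul hP hQ
  obtain ⟨s, hs1, hs⟩ := exists_le_smul h0 hPd
  -- Since `c⁻¹ • P ≤ Q`, the surplus multiple of `Q` removes at least the fraction `c⁻¹` of the
  -- deviation from `P` at each step.
  set r : ℝ := 1 - c⁻¹ with hr
  have hc0 : 0 < c := by linarith
  have hci : c⁻¹ ≤ 1 := inv_le_one_of_one_le₀ hc1
  have hci0 : 0 < c⁻¹ := inv_pos.2 hc0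
  have hr0 : 0 ≤ r := by linarith
  have hr1 : r < 1 := by linarith
  have hcQ : c⁻¹ • P ≤ Q := by
    have := smul_le_smul_left hc hci0.le
    rwa [smul_smul, inv_mul_cancel₀ hc0.ne', one_smul] at this
  have upper : ∀ k, p k ≤ (1 + r ^ k * s) • P := fun k => by
    induction k with
    | zero => exact hs.trans (smul_le_smul_right hP (by simp))
    | succ k ih =>
      have hk : 0 ≤ r ^ k * s := by positivity
      rw [hp]
      refine (riccati_mono hR (hpos k) ih).trans ((riccati_smul_le hR hP (by linarith)).trans ?_)
      rw [hfix]
      have := sub_le_sub_left (smul_le_smul_left hcQ hk) ((1 + r ^ k * s) • P)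
      rw [add_sub_cancel_left]
      refine this.trans (le_of_eq ?_)
      rw [pow_succ, hr]
      module
  -- The factor is 0 at `k = 0`, so a positive semidefinite start is enough.
  have lower : ∀ k, (1 - r ^ k) • P ≤ p k := fun k => by
    induction k with
    | zero => simpa using nonneg_iff_posSemidef.2 h0
    | succ k ih =>
      have hk : 0 ≤ r ^ k := by positivity
      have hk1 : r ^ k ≤ 1 := pow_le_one₀ hr0 hr1.le
      rw [hp]
      refine le_trans ?_ ((smul_riccati_le hR hP (by linarith) (by linarith)).trans
        (riccati_mono hR (hP.smul (by linarith : 0 ≤ 1 - r ^ k)) ih))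
      rw [hfix]
      have := add_le_add_right (smul_le_smul_left hcQ hk) ((1 - r ^ k) • P)
      rw [sub_sub_cancel]
      refine le_trans (le_of_eq ?_) this
      rw [pow_succ, hr]
      module
  refine tendsto_of_dotProduct_mulVec (fun k => (hpos k).transpose_eq) hP.transpose_eq fun x => ?_
  have hrk := tendsto_pow_atTop_nhds_zero_of_lt_one hr0 hr1
  refine tendsto_of_tendsto_of_tendsto_of_le_of_le
    (g := fun k => (1 - r ^ k) * (x ⬝ᵥ P *ᵥ x)) (h := fun k => (1 + r ^ k * s) * (x ⬝ᵥ P *ᵥ x))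
    ?_ ?_ (fun k => ?_) fun k => ?_
  · simpa using (hrk.const_sub 1).mul_const (x ⬝ᵥ P *ᵥ x)
  · simpa using ((hrk.mul_const s).const_add 1).mul_const (x ⬝ᵥ P *ᵥ x)
  · simpa [smul_mulVec] using dotProduct_mulVec_mono (lower k) x
  · simpa [smul_mulVec] using dotProduct_mulVec_mono (upper k) x

theorem riccati_fixedPoint_unique (hQ : Q.PosDef) (hR : R.PosDef) (hP : P.PosSemidef)
    (hfix : riccati A C Q R P = P) (hP' : P'.PosSemidef) (hfix' : riccati A C Q R P' = P') :
    P' = P :=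
  tendsto_nhds_unique tendsto_const_nhds
    (tendsto_riccati hQ hR hP hfix (p := fun _ => P') hP' fun _ => hfix'.symm)

end KalmanFilter

end

noncomputable section

namespace KalmanFilter

open scoped MatrixOrder

variable {n m : Type*} [Fintype n] [DecidableEq n] [Fintype m] [DecidableEq m]
  {A Q P : Matrix n n ℝ} {C : Matrix m n ℝ} {R : Matrix m m ℝ}

/-! ### Stability of the closed loop -/

theorem tendsto_zero_of_affine_recursion {r : ℝ} (hr0 : 0 ≤ r) (hr1 : r < 1) {s δ : ℕ → ℝ}
    (hs : ∀ k, 0 ≤ s k) (hδ : Tendsto δ atTop (𝓝 0)) (h : ∀ k, s (k + 1) ≤ r * s k + δ k) :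
    Tendsto s atTop (𝓝 0) := by
  rw [Metric.tendsto_atTop]
  intro ε hε
  -- With forcing `(1 - r) * (ε / 2)` the affine map has fixed point `ε / 2`, which leaves another
  -- `ε / 2` for the geometric transient.
  have hε' : 0 < (1 - r) * (ε / 2) := mul_pos (by linarith) (by linarith)
  obtain ⟨K, hK⟩ := eventually_atTop.1 (hδ.eventually (gt_mem_nhds hε'))
  have hb : ∀ j, s (K + j) ≤ ε / 2 + r ^ j * s K := fun j => by
    induction j with
    | zero => simp; linarith
    | succ j ih =>
      have h1 := h (K + j)
      have h2 := hK (K + j) (by omega)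
      have h3 := mul_le_mul_of_nonneg_left ih hr0
      rw [← add_assoc, pow_succ]
      linarith
  have hlim : Tendsto (fun j => r ^ j * s K) atTop (𝓝 0) := by
    simpa using (tendsto_pow_atTop_nhds_zero_of_lt_one hr0 hr1).mul_const (s K)
  obtain ⟨J, hJ⟩ := eventually_atTop.1 (hlim.eventually (gt_mem_nhds (half_pos hε)))
  refine ⟨K + J, fun k hk => ?_⟩
  have h1 := hb (k - K)
  have h2 := hJ (k - K) (by omega)
  rw [Nat.add_sub_cancel' (by omega)] at h1
  rw [Real.dist_eq, sub_zero, abs_of_nonneg (hs k)]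
  linarith

/-- The vector `x k` is measured in the norm dual to `y ↦ √(y ⬝ᵥ p k *ᵥ y)`, which avoids inverting
`p k`. By `hF`, passing `F k` to the other side as a transpose contracts this norm by `√r`. The
bound `Q ≤ p k` controls the forcing in it, and `p k ≤ c • Q` brings the result back to coordinates.
-/
theorem tendsto_zero_of_mul_mul_transpose_le {p F : ℕ → Matrix n n ℝ} {x d : ℕ → n → ℝ} {r c : ℝ}
    (hQ : Q.PosDef) (hr0 : 0 ≤ r) (hr1 : r < 1) (hQp : ∀ k, Q ≤ p k) (hpc : ∀ k, p k ≤ c • Q)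
    (hF : ∀ k, F k * p k * (F k)ᵀ ≤ r • p (k + 1)) (hx : ∀ k, x (k + 1) = F k *ᵥ x k + d k)
    (hd : Tendsto d atTop (𝓝 0)) : Tendsto x atTop (𝓝 0) := by
  obtain ⟨κ, hκ1, hκ⟩ := exists_le_smul (PosSemidef.one (n := n) (R := ℝ)) hQ
  -- Cauchy–Schwarz together with `1 ≤ κ • Q ≤ κ • p k`.
  have bound : ∀ (k : ℕ) (v y : n → ℝ),
      |v ⬝ᵥ y| ≤ √(κ * (v ⬝ᵥ v)) * √(y ⬝ᵥ p k *ᵥ y) := fun k v y => by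
    have hv : 0 ≤ v ⬝ᵥ v := by simpa using dotProduct_star_self_nonneg v
    rw [← Real.sqrt_mul (by positivity)]
    refine Real.abs_le_sqrt ?_
    have h1 : (v ⬝ᵥ y) ^ 2 ≤ (v ⬝ᵥ v) * (y ⬝ᵥ y) := by
      simpa [dotProduct, pow_two] using Finset.sum_mul_sq_le_sq_mul_sq Finset.univ v y
    have h2 := dotProduct_mulVec_mono hκ y
    have h3 := mul_le_mul_of_nonneg_left (dotProduct_mulVec_mono (hQp k) y)
      (by linarith : 0 ≤ κ)
    simp only [one_mulVec, smul_mulVec, dotProduct_smul, smul_eq_mul] at h2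
    have h4 := mul_le_mul_of_nonneg_left (h2.trans h3) hv
    linarith
  obtain ⟨s, hs0, hs⟩ : ∃ s : ℕ → ℝ, s 0 = √(κ * (x 0 ⬝ᵥ x 0)) ∧
      ∀ k, s (k + 1) = √r * s k + √(κ * (d k ⬝ᵥ d k)) :=
    ⟨fun k => Nat.rec √(κ * (x 0 ⬝ᵥ x 0)) (fun k t => √r * t + √(κ * (d k ⬝ᵥ d k))) k,
      rfl, fun _ => rfl⟩
  have hsn : ∀ k, 0 ≤ s k := fun k => by
    induction k with
    | zero => rw [hs0]; positivity
    | succ k ih => rw [hs]; positivity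
  have hxs : ∀ k y, |x k ⬝ᵥ y| ≤ s k * √(y ⬝ᵥ p k *ᵥ y) := fun k => by
    induction k with
    | zero => intro y; rw [hs0]; exact bound 0 _ y
    | succ k ih =>
      intro y
      have h1 : F k *ᵥ x k ⬝ᵥ y = x k ⬝ᵥ (F k)ᵀ *ᵥ y := by
        rw [mulVec_transpose, dotProduct_comm, dotProduct_mulVec, dotProduct_comm]
      have h2 : ((F k)ᵀ *ᵥ y) ⬝ᵥ p k *ᵥ ((F k)ᵀ *ᵥ y) = y ⬝ᵥ (F k * p k * (F k)ᵀ) *ᵥ y := by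
        rw [mulVec_transpose, ← dotProduct_mulVec, ← mulVec_transpose, mulVec_mulVec,
          mulVec_mulVec]
      have h3 : √(y ⬝ᵥ (F k * p k * (F k)ᵀ) *ᵥ y) ≤ √r * √(y ⬝ᵥ p (k + 1) *ᵥ y) := by
        rw [← Real.sqrt_mul hr0]
        refine Real.sqrt_le_sqrt ?_
        simpa [smul_mulVec] using dotProduct_mulVec_mono (hF k) y
      have h4 := ih ((F k)ᵀ *ᵥ y)
      rw [h2] at h4
      have h5 := mul_le_mul_of_nonneg_left h3 (hsn k)
      rw [hx, add_dotProduct, h1, hs]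
      refine (abs_add_le _ _).trans ?_
      have := bound (k + 1) (d k) y
      linarith
  have hδ : Tendsto (fun k => √(κ * (d k ⬝ᵥ d k))) atTop (𝓝 0) := by
    have : Continuous fun v : n → ℝ => √(κ * (v ⬝ᵥ v)) := by fun_prop
    simpa [Function.comp_def] using (this.tendsto 0).comp hd
  have hslim : Tendsto s atTop (𝓝 0) := tendsto_zero_of_affine_recursion (Real.sqrt_nonneg r)
    (by rw [← Real.sqrt_one]; exact Real.sqrt_lt_sqrt hr0 hr1) hsn hδ fun k => (hs k).le
  refine tendsto_pi_nhds.2 fun i => ?_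
  have hb : ∀ k, |x k i| ≤ s k * √(Pi.single i 1 ⬝ᵥ (c • Q) *ᵥ Pi.single i 1) := fun k => by
    have := hxs k (Pi.single i 1)
    rw [dotProduct_single_one] at this
    exact this.trans (mul_le_mul_of_nonneg_left
      (Real.sqrt_le_sqrt (dotProduct_mulVec_mono (hpc k) _)) (hsn k))
  exact squeeze_zero_norm hb (by simpa using hslim.mul_const _)

/-- The covariances are their own Lyapunov function. The bound `p k ≤ s • P` with `1 ≤ s` propagates
along the recursion, so `p k ≤ c • Q` uniformly, and subtracting `Q` costs at least the fraction
`c⁻¹` of `p (k + 1)`. -/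
theorem tendsto_zero_of_closedLoop (hQ : Q.PosDef) (hR : R.PosDef) (hP : P.PosSemidef)
    (hfix : riccati A C Q R P = P) {p : ℕ → Matrix n n ℝ} (h0 : Q ≤ p 0)
    (hp : ∀ k, p (k + 1) = riccati A C Q R (p k)) {x d : ℕ → n → ℝ}
    (hx : ∀ k, x (k + 1) = closedLoop A C R (p k) *ᵥ x k + d k)
    (hd : Tendsto d atTop (𝓝 0)) : Tendsto x atTop (𝓝 0) := by
  have hQp : ∀ k, Q ≤ p k := fun k => by
    induction k with
    | zero => exact h0
    | succ k ih => rw [hp]; exact le_riccati hR (posSemidef_of_le hQ.posSemidef ih)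
  have hpos : ∀ k, (p k).PosSemidef := fun k => posSemidef_of_le hQ.posSemidef (hQp k)
  obtain ⟨s, hs1, hs⟩ := exists_le_smul (hpos 0) (hfix ▸ posDef_riccati hQ hR hP)
  have hps : ∀ k, p k ≤ s • P := fun k => by
    induction k with
    | zero => exact hs
    | succ k ih =>
      rw [hp]
      refine (riccati_mono hR (hpos k) ih).trans ((riccati_smul_le hR hP hs1).trans ?_)
      rw [hfix]
      exact sub_le_self _ (nonneg_iff_posSemidef.2 (hQ.posSemidef.smul (by linarith)))
  obtain ⟨c, hc1, hc⟩ := exists_le_smul (hP.smul (by linarith : 0 ≤ s)) hQ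
  have hci0 : 0 < c⁻¹ := inv_pos.2 (by linarith)
  have hci : c⁻¹ ≤ 1 := inv_le_one_of_one_le₀ hc1
  have hpc : ∀ k, p k ≤ c • Q := fun k => (hps k).trans hc
  refine tendsto_zero_of_mul_mul_transpose_le (r := 1 - c⁻¹) hQ (by linarith) (by linarith)
    hQp hpc (fun k => ?_) hx hd
  refine (closedLoop_mul_mul_transpose_le (Q := Q) hR (hpos k)).trans ?_
  rw [← hp, sub_smul, one_smul]
  refine sub_le_sub_left ?_ _
  have := smul_le_smul_left (hpc (k + 1)) hci0.le
  rwa [smul_smul, inv_mul_cancel₀ (by linarith : c ≠ 0), one_smul] at this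

/-- The two rows of `X` form a cascade, since `!![1, τ; 0, 1]` is unipotent. -/
theorem tendsto_zero_of_closedLoop_matrix (τ : ℝ) (hQ : Q.PosDef) (hR : R.PosDef)
    (hP : P.PosSemidef) (hfix : riccati A C Q R P = P) {p : ℕ → Matrix n n ℝ} (h0 : Q ≤ p 0)
    (hp : ∀ k, p (k + 1) = riccati A C Q R (p k)) {X D : ℕ → Matrix (Fin 2) n ℝ}
    (hX : ∀ k, X (k + 1) = !![1, τ; 0, 1] * X k * (closedLoop A C R (p k))ᵀ + D k)
    (hD : Tendsto D atTop (𝓝 0)) : Tendsto X atTop (𝓝 0) := by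
  have hrow : ∀ k, X (k + 1) 1 = closedLoop A C R (p k) *ᵥ X k 1 + D k 1 ∧
      X (k + 1) 0 = closedLoop A C R (p k) *ᵥ X k 0
        + (τ • (closedLoop A C R (p k) *ᵥ X k 1) + D k 0) := fun k => by
    rw [hX]
    generalize closedLoop A C R (p k) = F
    have hG : ∀ i j, (X k * Fᵀ) i j = (F *ᵥ X k i) j := fun i j => by
      simp [Matrix.mul_apply, mulVec, dotProduct, mul_comm]
    rw [Matrix.mul_assoc]
    constructor <;> ext j <;>
      simp [vecMul_eq_sum, Fin.sum_univ_two, hG, add_assoc]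
  have hD' : ∀ i, Tendsto (fun k => D k i) atTop (𝓝 0) := fun i => tendsto_pi_nhds.1 hD i
  have h1 : Tendsto (fun k => X k 1) atTop (𝓝 0) :=
    tendsto_zero_of_closedLoop hQ hR hP hfix h0 hp (fun k => (hrow k).1) (hD' 1)
  -- The coupling term is the next value of row 1 minus its forcing, so no bound on the closed loop
  -- matrices is needed.
  have h2 : Tendsto (fun k => closedLoop A C R (p k) *ᵥ X k 1) atTop (𝓝 0) := by
    have := ((tendsto_add_atTop_iff_nat 1).2 h1).sub (hD' 1)
    simp_rw [(hrow _).1, add_sub_cancel_right, sub_zero] at this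
    exact this
  have h3 : Tendsto (fun k => X k 0) atTop (𝓝 0) :=
    tendsto_zero_of_closedLoop hQ hR hP hfix h0 hp (fun k => (hrow k).2)
      (by simpa using (h2.const_smul τ).add (hD' 0))
  refine tendsto_pi_nhds.2 fun i => ?_
  fin_cases i
  · exact h3
  · exact h1

/-- The constant sequence `X` is an orbit of the stable homogeneous recursion, hence equals its
limit 0. -/
theorem eq_zero_of_closedLoop_matrix (τ : ℝ) (hQ : Q.PosDef) (hR : R.PosDef)
    (hP : P.PosSemidef) (hfix : riccati A C Q R P = P) {X : Matrix (Fin 2) n ℝ}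
    (hX : X = !![1, τ; 0, 1] * X * (closedLoop A C R P)ᵀ) : X = 0 :=
  tendsto_nhds_unique tendsto_const_nhds
    (tendsto_zero_of_closedLoop_matrix τ hQ hR hP hfix (p := fun _ => P) (X := fun _ => X)
      (D := fun _ => 0) (by rw [← hfix]; exact le_riccati hR hP) (fun _ => hfix.symm)
      (fun _ => by rw [add_zero]; exact hX) tendsto_const_nhds)

/-- The linear equation `X = D + !![1, τ; 0, 1] X Fᵀ` with `F` the stationary closed loop is
solvable. -/
theorem exists_eq_closedLoop_matrix (τ : ℝ) (hQ : Q.PosDef) (hR : R.PosDef)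
    (hP : P.PosSemidef) (hfix : riccati A C Q R P = P) (D : Matrix (Fin 2) n ℝ) :
    ∃ X : Matrix (Fin 2) n ℝ, X = D + !![1, τ; 0, 1] * X * (closedLoop A C R P)ᵀ := by
  let T : Matrix (Fin 2) n ℝ →ₗ[ℝ] Matrix (Fin 2) n ℝ :=
    { toFun := fun X => X - !![1, τ; 0, 1] * X * (closedLoop A C R P)ᵀ
      map_add' := fun X Y => by rw [Matrix.mul_add, Matrix.add_mul]; abel
      map_smul' := fun t X => by
        rw [Matrix.mul_smul, Matrix.smul_mul, RingHom.id_apply, smul_sub] }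
  have hinj : Function.Injective T := by
    rw [injective_iff_map_eq_zero]
    exact fun X hX => eq_zero_of_closedLoop_matrix τ hQ hR hP hfix (sub_eq_zero.1 hX)
  obtain ⟨X, hX⟩ := LinearMap.injective_iff_surjective.1 hinj D
  exact ⟨X, sub_eq_iff_eq_add.1 hX⟩

/-- The real and imaginary parts of `z ^ k • v` are orbits of the real closed loop and tend to 0,
whereas `1 ≤ ‖z‖` would keep a nonzero coordinate of `v` away from 0. -/
theorem norm_lt_one_of_closedLoop_mulVec (hQ : Q.PosDef) (hR : R.PosDef)
    (hP : P.PosSemidef) (hfix : riccati A C Q R P = P) {z : ℂ} {v : n → ℂ} (hv : v ≠ 0)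
    (hzv : (closedLoop A C R P).map (algebraMap ℝ ℂ) *ᵥ v = z • v) : ‖z‖ < 1 := by
  have hstep : ∀ k i, z ^ (k + 1) * v i
      = ∑ j, ((closedLoop A C R P i j : ℝ) : ℂ) * (z ^ k * v j) := fun k i => by
    have := congr_fun hzv i
    simp only [mulVec, dotProduct, map_apply, Complex.coe_algebraMap, Pi.smul_apply,
      smul_eq_mul] at this
    rw [pow_succ, mul_assoc, ← this, Finset.mul_sum]
    exact Finset.sum_congr rfl fun j _ => by ring
  have lim : ∀ x : ℕ → n → ℝ, (∀ k, x (k + 1) = closedLoop A C R P *ᵥ x k) →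
      Tendsto x atTop (𝓝 0) := fun x hx =>
    tendsto_zero_of_closedLoop hQ hR hP hfix (p := fun _ => P) (d := fun _ => 0)
      (by rw [← hfix]; exact le_riccati hR hP) (fun _ => hfix.symm)
      (fun k => by rw [add_zero]; exact hx k) tendsto_const_nhds
  have hre := lim (fun k i => (z ^ k * v i).re) fun k => by
    ext i
    rw [hstep, Complex.re_sum]
    simp only [Complex.re_ofReal_mul]
    rfl
  have him := lim (fun k i => (z ^ k * v i).im) fun k => by
    ext i
    rw [hstep, Complex.im_sum]
    simp only [Complex.im_ofReal_mul]
    rfl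
  obtain ⟨i, hi⟩ := Function.ne_iff.1 hv
  have hnorm : Tendsto (fun k => ‖z ^ k * v i‖) atTop (𝓝 0) :=
    squeeze_zero (fun k => norm_nonneg _) (fun k => Complex.norm_le_abs_re_add_abs_im _)
      (by simpa using ((tendsto_pi_nhds.1 hre i).abs).add ((tendsto_pi_nhds.1 him i).abs))
  by_contra! hz
  have : ‖v i‖ ≤ 0 := ge_of_tendsto' hnorm fun k => by
    rw [norm_mul, norm_pow]
    exact le_mul_of_one_le_left (norm_nonneg _) (one_le_pow₀ hz)
  exact hi (norm_le_zero_iff.1 this)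

theorem exists_mulVec_eq_smul_of_mem_spectrum {M : Matrix n n ℂ} {z : ℂ} (hz : z ∈ spectrum ℂ M) :
    ∃ v, v ≠ 0 ∧ M *ᵥ v = z • v := by
  rw [← Matrix.spectrum_toLin', ← Module.End.hasEigenvalue_iff_mem_spectrum] at hz
  obtain ⟨v, hv⟩ := hz.exists_hasEigenvector
  exact ⟨v, hv.2, by simpa using hv.apply_eq_smul⟩

/-- By block triangularity, the slice `v (·, 1)` of an eigenvector, or `v (·, 0)` when that slice
vanishes, is an eigenvector of the closed loop for the same eigenvalue. -/
theorem norm_lt_one_of_mem_spectrum_closedLoop_kronecker (τ : ℝ) (hQ : Q.PosDef) (hR : R.PosDef)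
    (hP : P.PosSemidef) (hfix : riccati A C Q R P = P) {z : ℂ}
    (hz : z ∈ spectrum ℂ
      ((closedLoop A C R P ⊗ₖ !![1, τ; 0, 1]).map (algebraMap ℝ ℂ))) : ‖z‖ < 1 := by
  obtain ⟨v, hv, hzv⟩ := exists_mulVec_eq_smul_of_mem_spectrum hz
  have h1 : (closedLoop A C R P).map (algebraMap ℝ ℂ) *ᵥ (fun i => v (i, 1))
      = z • fun i => v (i, 1) := by
    ext i
    have := congr_fun hzv (i, 1)
    simpa [mulVec, dotProduct, Fintype.sum_prod_type, Fin.sum_univ_two] using this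
  by_cases hv1 : (fun i => v (i, 1)) = 0
  · have h0 : (closedLoop A C R P).map (algebraMap ℝ ℂ) *ᵥ (fun i => v (i, 0))
        = z • fun i => v (i, 0) := by
      ext i
      have := congr_fun hzv (i, 0)
      have hv1' : ∀ j, v (j, 1) = 0 := congr_fun hv1
      simpa [mulVec, dotProduct, Fintype.sum_prod_type, Fin.sum_univ_two, hv1'] using this
    refine norm_lt_one_of_closedLoop_mulVec hQ hR hP hfix (fun hv0 => hv ?_) h0
    ext ⟨i, a⟩
    fin_cases a
    · exact congr_fun hv0 i
    · exact congr_fun hv1 i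
  · exact norm_lt_one_of_closedLoop_mulVec hQ hR hP hfix hv1 h1

end KalmanFilter

end

noncomputable section

namespace ClockEnsemble

open KalmanFilter
open scoped MatrixOrder

variable {N : ℕ} (E : ClockEnsemble N)

/-! ### The observable subsystem -/

theorem Q_apply (x y : Fin 2 × Fin N) : E.Q x y =
    (!![E.τ • E.Sig₁ + (E.τ ^ 3 / 3) • E.Sig₂, (E.τ ^ 2 / 2) • E.Sig₂;
       (E.τ ^ 2 / 2) • E.Sig₂, E.τ • E.Sig₂] : Matrix (Fin 2) (Fin 2) (Matrix (Fin N) (Fin N) ℝ))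
      x.1 y.1 x.2 y.2 :=
  rfl

theorem posDef_Q : E.Q.PosDef := by
  refine PosDef.of_dotProduct_mulVec_pos ?_ fun x hx => ?_
  · rw [isHermitian_iff_transpose_eq]
    ext ⟨i, a⟩ ⟨j, b⟩
    by_cases hab : a = b
    · subst hab
      fin_cases i <;> fin_cases j <;> simp [Q_apply]
    · fin_cases i <;> fin_cases j <;>
        simp [Q_apply, Sig₁, Sig₂, diagonal_apply_ne _ hab, diagonal_apply_ne _ (Ne.symm hab)]
  -- The form decouples over clocks; completing the square in `x (1, a)` leaves `τ ^ 2 / 3 - τ ^ 2 /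
  -- 4 = τ ^ 2 / 12`.
  · have key : star x ⬝ᵥ E.Q *ᵥ x = ∑ a, (E.τ * (E.σ₁ a * x (0, a)) ^ 2
        + E.τ * E.σ₂ a ^ 2 * ((x (1, a) + E.τ / 2 * x (0, a)) ^ 2
          + E.τ ^ 2 / 12 * x (0, a) ^ 2)) := by
      simp only [dotProduct, mulVec, Fintype.sum_prod_type, Fin.sum_univ_two, Q_apply, Sig₁, Sig₂,
        of_apply, cons_val_zero, cons_val_one, cons_val', Pi.star_apply,
        star_trivial, Matrix.add_apply, Matrix.smul_apply, diagonal_apply, smul_eq_mul,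
        mul_ite, mul_zero, ite_mul, zero_mul, add_mul, Finset.sum_add_distrib,
        Finset.sum_ite_eq, Finset.mem_univ, if_true, cons_val_fin_one]
      simp only [← Finset.sum_add_distrib]
      exact Finset.sum_congr rfl fun a _ => by ring
    rw [key]
    have hτ := E.τ_pos
    obtain ⟨⟨i, a⟩, hxa⟩ := Function.ne_iff.1 hx
    refine Finset.sum_pos' (fun a _ => by positivity) ⟨a, Finset.mem_univ a, ?_⟩
    have hσ := E.σ₂_pos a
    refine add_pos_of_nonneg_of_pos (by positivity) (mul_pos (by positivity) ?_)
    by_cases h0 : x (0, a) = 0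
    · have h1 : x (1, a) ≠ 0 := by
        fin_cases i
        · exact absurd h0 hxa
        · exact hxa
      have h2 : 0 < x (1, a) ^ 2 := by positivity
      simpa [h0] using h2
    · positivity

theorem mulVec_V_surjective : Function.Surjective E.V.mulVecLin := by
  -- For `N = 0` the vector of ones is zero, so the kernel is not a line and the rank count below
  -- does not apply.
  rcases Nat.eq_zero_or_pos N with rfl | hN
  · exact fun y => ⟨0, funext fun i => i.elim0⟩
  rw [← LinearMap.range_eq_top]
  apply Submodule.eq_top_of_finrank_eq
  have h := E.V.mulVecLin.finrank_range_add_finrank_ker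
  have h1 : (fun _ : Fin N => (1 : ℝ)) ≠ 0 := fun h => one_ne_zero (congr_fun h ⟨0, hN⟩)
  rw [E.ker_V, finrank_span_singleton h1, Module.finrank_fin_fun] at h
  rw [Module.finrank_fin_fun]
  omega

/-- A block in the left kernel of `V` is orthogonal to the range of `V`, which is everything, hence
to itself. -/
theorem vecMul_bV_injective : Function.Injective E.bV.vecMul := by
  rw [← Matrix.coe_vecMulLinear, injective_iff_map_eq_zero]
  intro x hx
  have hV : ∀ i, (fun a => x (i, a)) ᵥ* E.V = 0 := fun i => by
    ext b
    have := congr_fun hx (i, b)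
    simpa [bV, vecMul, dotProduct, Fintype.sum_prod_type, one_apply] using this
  ext ⟨i, a⟩
  obtain ⟨y, hy⟩ := E.mulVec_V_surjective (fun a => x (i, a))
  have : (fun a => x (i, a)) ⬝ᵥ (fun a => x (i, a)) = 0 := by
    nth_rewrite 2 [← hy]
    rw [mulVecLin_apply, dotProduct_mulVec, hV, zero_dotProduct]
  exact congr_fun (dotProduct_self_eq_zero.1 this) a

theorem posDef_Qo : E.Qo.PosDef := by
  have := E.posDef_Q.mul_mul_conjTranspose_same E.vecMul_bV_injective
  rwa [conjTranspose_eq_transpose_of_trivial] at this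

/-- The gain `[1; 1/τ] ⊗ I` is deadbeat. -/
theorem exists_deadbeat_gain :
    ∃ K : Matrix (Fin 2 × Fin (N - 1)) (Fin (N - 1)) ℝ,
      E.Ao * (1 - K * E.Co) * (E.Ao * (1 - K * E.Co)) = 0 := by
  let e : Fin (N - 1) ≃ Fin 1 × Fin (N - 1) := (Equiv.uniqueProd _ _).symm
  refine ⟨((!![1; E.τ⁻¹] : Matrix (Fin 2) (Fin 1) ℝ) ⊗ₖ
    (1 : Matrix (Fin (N - 1)) (Fin (N - 1)) ℝ)).submatrix id e, ?_⟩
  have hCo : E.Co = (C ⊗ₖ (1 : Matrix (Fin (N - 1)) (Fin (N - 1)) ℝ)).submatrix e id := rfl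
  have h1 : (1 : Matrix (Fin 2 × Fin (N - 1)) (Fin 2 × Fin (N - 1)) ℝ)
      = (1 : Matrix (Fin 2) (Fin 2) ℝ) ⊗ₖ 1 := one_kronecker_one.symm
  have h2 : ∀ X : Matrix (Fin 2) (Fin 2) ℝ,
      1 - X ⊗ₖ (1 : Matrix (Fin (N - 1)) (Fin (N - 1)) ℝ) = (1 - X) ⊗ₖ 1 := fun X => by
    rw [h1, sub_eq_iff_eq_add, ← add_kronecker, sub_add_cancel]
  have hτ := E.τ_pos.ne'
  rw [hCo, submatrix_mul_equiv, ← mul_kronecker_mul, submatrix_id_id, Matrix.mul_one,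
    h2, Ao, ← mul_kronecker_mul, ← mul_kronecker_mul]
  convert zero_kronecker _
  -- Trace and determinant vanish, so the square is zero.
  have h3 : E.A * (1 - !![1; E.τ⁻¹] * C) = !![-1, E.τ; -E.τ⁻¹, 1] := by
    rw [one_fin_two, A, C]
    ext i j
    fin_cases i <;> fin_cases j <;> simp [Matrix.mul_apply, Fin.sum_univ_two, hτ]
  rw [h3]
  ext i j
  fin_cases i <;> fin_cases j <;> simp [Matrix.mul_apply, Fin.sum_univ_two, hτ]

variable {P : Matrix (Fin 2 × Fin (N - 1)) (Fin 2 × Fin (N - 1)) ℝ}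

theorem mul_S (P : Matrix (Fin 2 × Fin (N - 1)) (Fin 2 × Fin (N - 1)) ℝ) :
    P * E.S P = posterior E.Co E.R P := by
  rw [S, posterior, gain, Matrix.mul_sub, Matrix.sub_mul, Matrix.mul_one, Matrix.one_mul]
  simp only [Matrix.mul_assoc]

theorem riccati_eq (P : Matrix (Fin 2 × Fin (N - 1)) (Fin 2 × Fin (N - 1)) ℝ) :
    riccati E.Ao E.Co E.Qo E.R P = E.Qo + E.Ao * P * E.S P * E.Aoᵀ := by
  rw [riccati, ← mul_S, add_comm, ← Matrix.mul_assoc E.Ao]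

theorem S_eq (hP : P.PosSemidef) : E.S P = 1 - E.Coᵀ * (gain E.Co E.R P)ᵀ := by
  rw [S, gain, transpose_mul, transpose_mul, transpose_transpose, hP.transpose_eq,
    (posDef_innovation E.R_posDef hP).inv.posSemidef.transpose_eq]
  simp only [Matrix.mul_assoc]

/-- This puts the cross covariance equations in the form `X ↦ A X Fᵀ` to which the stability results
apply. -/
theorem S_mul_transpose (hP : P.PosSemidef) :
    E.S P * E.Aoᵀ = (closedLoop E.Ao E.Co E.R P)ᵀ := by
  rw [S_eq E hP, closedLoop, transpose_mul, transpose_sub, transpose_mul, transpose_one]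

theorem exists_stationary_Poo : ∃ P : Matrix (Fin 2 × Fin (N - 1)) (Fin 2 × Fin (N - 1)) ℝ,
    P.PosSemidef ∧ riccati E.Ao E.Co E.Qo E.R P = P := by
  obtain ⟨K, hK⟩ := E.exists_deadbeat_gain
  exact exists_riccati_eq E.posDef_Qo E.R_posDef
    (exists_riccati_le E.posDef_Qo E.R_posDef K hK)

/-! ### Runs of the covariance equations -/

variable {b : BasisParameter N} {k₀ : ℤ} {c : KFCovariances N}

namespace CovarianceEquations

variable {E}

theorem Ho_eq_gain (h : E.CovarianceEquations b k₀ c) {k : ℤ} (hk : k₀ < k) :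
    c.Ho k = gain E.Co E.R (c.PooPrior k) :=
  h.Ho_eq k hk

theorem PooPost_eq_posterior (h : E.CovarianceEquations b k₀ c) {k : ℤ} (hk : k₀ < k) :
    c.PooPost k = posterior E.Co E.R (c.PooPrior k) := by
  rw [h.PooPost_eq k hk, h.Ho_eq_gain hk, posterior]

theorem PooPrior_succ (h : E.CovarianceEquations b k₀ c) {k : ℤ} (hk : k₀ < k) :
    c.PooPrior (k + 1) = riccati E.Ao E.Co E.Qo E.R (c.PooPrior k) := by
  rw [h.PooPrior_eq (k + 1) (by omega), add_sub_cancel_right, h.PooPost_eq_posterior hk, riccati]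

theorem PuoPrior_succ (h : E.CovarianceEquations b k₀ c) {k : ℤ} (hk : k₀ < k)
    (hP : (c.PooPrior k).PosSemidef) :
    c.PuoPrior (k + 1) = E.Qu b + (E.A * c.PuoPrior k + E.coupling b * c.PooPrior k)
      * E.S (c.PooPrior k) * E.Aoᵀ := by
  rw [h.PuoPrior_eq (k + 1) (by omega), add_sub_cancel_right, h.PooPost_eq_posterior hk,
    h.PuoPost_eq k hk, h.Ho_eq_gain hk, ← S_eq E hP, ← mul_S, ← Matrix.mul_assoc,
    ← Matrix.mul_assoc, ← Matrix.add_mul, add_comm (E.Qu b), add_comm (_ * c.PooPrior k)]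

end CovarianceEquations

theorem tendsto_atTop_of_nat_shift {α : Type*} [TopologicalSpace α] {f : ℤ → α} {a : α} (k₀ : ℤ)
    (h : Tendsto (fun k : ℕ => f (k₀ + k)) atTop (𝓝 a)) : Tendsto f atTop (𝓝 a) := by
  have ht : Tendsto (fun k : ℤ => (k - k₀).toNat) atTop atTop :=
    tendsto_atTop_atTop.2 fun m => ⟨k₀ + m, fun k hk => by omega⟩
  refine (h.comp ht).congr' ?_
  filter_upwards [eventually_ge_atTop k₀] with k hk
  simp only [Function.comp_apply]
  congr 1
  omega

/-- The error `PuoPrior - X` obeys the closed loop recursion with a forcing that vanishes as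
`PooPrior` approaches `P`. -/
theorem CovarianceEquations.tendsto (h : E.CovarianceEquations b k₀ c)
    (h0 : (c.PooPost k₀).PosSemidef) (hP : P.PosSemidef)
    (hfix : riccati E.Ao E.Co E.Qo E.R P = P) {X : Matrix (Fin 2) (Fin 2 × Fin (N - 1)) ℝ}
    (hX : X = E.Qu b + (E.A * X + E.coupling b * P) * E.S P * E.Aoᵀ) :
    Tendsto c.PooPrior atTop (𝓝 P) ∧ Tendsto c.PuoPrior atTop (𝓝 X) ∧
      Tendsto c.Ho atTop (𝓝 (gain E.Co E.R P)) ∧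
      Tendsto c.Hu atTop (𝓝 (X * E.Coᵀ * (E.Co * P * E.Coᵀ + E.R)⁻¹)) := by
  -- Time `k₀ + 1` carries the first prior governed by the equations, and that prior already
  -- dominates `Qo`.
  set p : ℕ → Matrix (Fin 2 × Fin (N - 1)) (Fin 2 × Fin (N - 1)) ℝ :=
    fun k => c.PooPrior (k₀ + 1 + k) with hpdef
  have hp : ∀ k, p (k + 1) = riccati E.Ao E.Co E.Qo E.R (p k) := fun k => by
    rw [hpdef]
    simp only [Nat.cast_add, Nat.cast_one, ← add_assoc]
    exact h.PooPrior_succ (by omega)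
  have hQ0 : E.Qo ≤ p 0 := by
    simp only [hpdef, Nat.cast_zero, add_zero]
    rw [h.PooPrior_eq (k₀ + 1) (by omega), add_sub_cancel_right]
    exact le_add_of_nonneg_left (nonneg_iff_posSemidef.2 (posSemidef_mul_mul_transpose h0 _))
  have hpos : ∀ k, (p k).PosSemidef := fun k => by
    induction k with
    | zero => exact posSemidef_of_le E.posDef_Qo.posSemidef hQ0
    | succ k ih => rw [hp]; exact (posDef_riccati E.posDef_Qo E.R_posDef ih).posSemidef
  have hlim : Tendsto p atTop (𝓝 P) :=
    tendsto_riccati E.posDef_Qo E.R_posDef hP hfix (hpos 0) hp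
  have hgain : Tendsto (fun k => gain E.Co E.R (p k)) atTop (𝓝 (gain E.Co E.R P)) :=
    (continuousAt_gain E.R_posDef hP).tendsto.comp hlim
  have hF : Tendsto (fun k => (closedLoop E.Ao E.Co E.R (p k))ᵀ) atTop
      (𝓝 (closedLoop E.Ao E.Co E.R P)ᵀ) :=
    (continuous_id.matrix_transpose.tendsto _).comp
      (tendsto_const_nhds.matrix_mul (tendsto_const_nhds.sub
        (hgain.matrix_mul tendsto_const_nhds)))
  have herr : Tendsto (fun k : ℕ => c.PuoPrior (k₀ + 1 + k) - X) atTop (𝓝 0) := by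
    refine tendsto_zero_of_closedLoop_matrix E.τ E.posDef_Qo E.R_posDef hP hfix hQ0 hp
      -- `D k` is the defect of the limit `X` in the recursion at time `k`: the same expression at
      -- `p k` minus its value at `P`.
      (D := fun k => (E.A * X + E.coupling b * p k) * (closedLoop E.Ao E.Co E.R (p k))ᵀ
        - (E.A * X + E.coupling b * P) * (closedLoop E.Ao E.Co E.R P)ᵀ) (fun k => ?_) ?_
    · have h1 := h.PuoPrior_succ (k := k₀ + 1 + k) (by omega) (hpos k)
      have h2 : X = E.Qu b + (E.A * X + E.coupling b * P) * (closedLoop E.Ao E.Co E.R P)ᵀ := by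
        rwa [← S_mul_transpose E hP, ← Matrix.mul_assoc]
      rw [Matrix.mul_assoc, S_mul_transpose E (hpos k)] at h1
      simp only [Nat.cast_add, Nat.cast_one, ← add_assoc]
      rw [h1]
      nth_rewrite 1 [h2]
      rw [show !![1, E.τ; 0, 1] = E.A from rfl]
      simp only [Matrix.add_mul, Matrix.mul_sub, Matrix.sub_mul, hpdef]
      abel
    · have := (((tendsto_const_nhds (x := E.A * X)).add
        ((tendsto_const_nhds (x := E.coupling b)).matrix_mul hlim)).matrix_mul hF).sub_const
        ((E.A * X + E.coupling b * P) * (closedLoop E.Ao E.Co E.R P)ᵀ)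
      rwa [sub_self] at this
  have hPuo : Tendsto (fun k : ℕ => c.PuoPrior (k₀ + 1 + k)) atTop (𝓝 X) := by
    simpa using herr.add_const X
  have hinv : Tendsto (fun k => (E.Co * p k * E.Coᵀ + E.R)⁻¹) atTop
      (𝓝 (E.Co * P * E.Coᵀ + E.R)⁻¹) :=
    (continuousAt_innovation_inv E.R_posDef hP).tendsto.comp hlim
  refine ⟨tendsto_atTop_of_nat_shift (k₀ + 1) hlim, tendsto_atTop_of_nat_shift (k₀ + 1) hPuo,
    tendsto_atTop_of_nat_shift (k₀ + 1) (hgain.congr fun k => ?_),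
    tendsto_atTop_of_nat_shift (k₀ + 1)
      (((hPuo.matrix_mul tendsto_const_nhds).matrix_mul hinv).congr fun k => ?_)⟩
  · exact (h.Ho_eq_gain (by omega)).symm
  · exact (h.Hu_eq _ (by omega)).symm

theorem CovarianceEquations.eq_of_stationary (h : E.CovarianceEquations b k₀ c)
    (hP : P.PosSemidef) (hfix : riccati E.Ao E.Co E.Qo E.R P = P)
    {X : Matrix (Fin 2) (Fin 2 × Fin (N - 1)) ℝ}
    (hX : X = E.Qu b + (E.A * X + E.coupling b * P) * E.S P * E.Aoᵀ)
    (hPoo : c.PooPrior (k₀ + 1) = P) (hPuo : c.PuoPrior (k₀ + 1) = X) :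
    ∀ k > k₀, c.PooPrior k = P ∧ c.PuoPrior k = X := by
  intro k hk
  induction k, Int.add_one_le_of_lt hk using Int.leInduction with
  | base => exact ⟨hPoo, hPuo⟩
  | succ k hk' ih =>
    obtain ⟨h1, h2⟩ := ih (by omega)
    refine ⟨by rw [h.PooPrior_succ (by omega), h1, hfix], ?_⟩
    rw [h.PuoPrior_succ (by omega) (h1 ▸ hP), h1, h2, ← hX]

/-- The run of the covariance equations that stays at a stationary solution. -/
def stationaryCovariances (P : Matrix (Fin 2 × Fin (N - 1)) (Fin 2 × Fin (N - 1)) ℝ)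
    (X : Matrix (Fin 2) (Fin 2 × Fin (N - 1)) ℝ) : KFCovariances N where
  PooPrior _ := P
  PuoPrior _ := X
  Ho _ := gain E.Co E.R P
  Hu _ := X * E.Coᵀ * (E.Co * P * E.Coᵀ + E.R)⁻¹
  PooPost _ := posterior E.Co E.R P
  PuoPost _ := X * E.S P

theorem covarianceEquations_stationaryCovariances (hP : P.PosSemidef)
    (hfix : riccati E.Ao E.Co E.Qo E.R P = P) {X : Matrix (Fin 2) (Fin 2 × Fin (N - 1)) ℝ}
    (hX : X = E.Qu b + (E.A * X + E.coupling b * P) * E.S P * E.Aoᵀ) :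
    E.CovarianceEquations b k₀ (E.stationaryCovariances P X) where
  PooPrior_eq _ _ := hfix.symm
  PuoPrior_eq _ _ := by
    refine hX.trans ?_
    simp only [stationaryCovariances]
    rw [← mul_S, ← Matrix.mul_assoc, ← Matrix.mul_assoc, ← Matrix.add_mul, add_comm (E.Qu b),
      add_comm (E.A * X)]
  Ho_eq _ _ := rfl
  Hu_eq _ _ := rfl
  PooPost_eq _ _ := rfl
  PuoPost_eq _ _ := by
    simp only [stationaryCovariances]
    rw [S_eq E hP]

end ClockEnsemble

end

/-! ### The stationary filter -/

theorem theorem1 {N : ℕ} (E : ClockEnsemble N) (b : BasisParameter N) :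
    ∃ (Poo : Matrix (Fin 2 × Fin (N - 1)) (Fin 2 × Fin (N - 1)) ℝ)
      (Puo : Matrix (Fin 2) (Fin 2 × Fin (N - 1)) ℝ)
      (Hos : Matrix (Fin 2 × Fin (N - 1)) (Fin (N - 1)) ℝ)
      (Hus : Matrix (Fin 2) (Fin (N - 1)) ℝ),
      -- `Poo`, `Puo` and `Hos`, `Hus` are the limits of the prior covariances and of the gains,
      -- whatever the initial covariances
      (∀ (k₀ : ℤ) (c : KFCovariances N), E.CovarianceEquations b k₀ c → (c.PooPost k₀).PosSemidef →
        Tendsto c.PooPrior atTop (𝓝 Poo) ∧ Tendsto c.PuoPrior atTop (𝓝 Puo) ∧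
        Tendsto c.Ho atTop (𝓝 Hos) ∧ Tendsto c.Hu atTop (𝓝 Hus)) ∧
      -- `Poo` is the unique positive semidefinite solution of the Riccati equation
      (Poo.PosSemidef ∧ Poo = E.Qo + E.Ao * Poo * E.S Poo * E.Aoᵀ) ∧
      (∀ P : Matrix (Fin 2 × Fin (N - 1)) (Fin 2 × Fin (N - 1)) ℝ,
        P.PosSemidef → P = E.Qo + E.Ao * P * E.S P * E.Aoᵀ → P = Poo) ∧
      -- `Puo` is the unique solution of the linear equation
      (Puo = E.Qu b + (E.A * Puo + E.coupling b * Poo) * E.S Poo * E.Aoᵀ) ∧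
      (∀ X : Matrix (Fin 2) (Fin 2 × Fin (N - 1)) ℝ,
        X = E.Qu b + (E.A * X + E.coupling b * Poo) * E.S Poo * E.Aoᵀ → X = Puo) ∧
      -- the stationary gains
      Hos = Poo * E.Coᵀ * (E.Co * Poo * E.Coᵀ + E.R)⁻¹ ∧
      Hus = Puo * E.Coᵀ * (E.Co * Poo * E.Coᵀ + E.R)⁻¹ ∧
      -- once the prior covariances are stationary, they and the gains stay so, and the
      -- determinate algorithm is the stationary one
      (∀ (k₀ : ℤ) (u : ℤ → Fin N → ℝ) (y : ℤ → Fin (N - 1) → ℝ)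
          (c : KFCovariances N) (e : KFEstimates N),
        E.IsDeterminateKF b k₀ u y c e →
        c.PooPrior (k₀ + 1) = Poo → c.PuoPrior (k₀ + 1) = Puo →
        (∀ k > k₀, c.PooPrior k = Poo ∧ c.PuoPrior k = Puo ∧ c.Ho k = Hos ∧ c.Hu k = Hus) ∧
        E.IsStationaryKF b k₀ u y Hos Hus e) ∧
      -- every run of the stationary algorithm arises in this way
      (∀ (k₀ : ℤ) (u : ℤ → Fin N → ℝ) (y : ℤ → Fin (N - 1) → ℝ) (e : KFEstimates N),
        E.IsStationaryKF b k₀ u y Hos Hus e →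
        ∃ c : KFCovariances N, (c.PooPost k₀).PosSemidef ∧ E.IsDeterminateKF b k₀ u y c e ∧
          c.PooPrior (k₀ + 1) = Poo ∧ c.PuoPrior (k₀ + 1) = Puo) ∧
      -- the closed-loop matrix of the linear equation is Schur stable
      (∀ z ∈ spectrum ℂ
          (((E.Ao * (1 - Hos * E.Co)) ⊗ₖ E.A).map (algebraMap ℝ ℂ)), ‖z‖ < 1) := by
  obtain ⟨P, hP, hfix⟩ := E.exists_stationary_Poo
  -- Separates the part independent of `X` from the linear part, so that existence is solvability of
  -- a linear equation and uniqueness concerns the homogeneous one.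
  have hfixS : ∀ X : Matrix (Fin 2) (Fin 2 × Fin (N - 1)) ℝ,
      (E.A * X + E.coupling b * P) * E.S P * E.Aoᵀ = E.coupling b * P *
        (KalmanFilter.closedLoop E.Ao E.Co E.R P)ᵀ
        + !![1, E.τ; 0, 1] * X * (KalmanFilter.closedLoop E.Ao E.Co E.R P)ᵀ := fun X => by
    rw [Matrix.mul_assoc, E.S_mul_transpose hP, add_comm, Matrix.add_mul]
    rfl
  obtain ⟨X, hX⟩ := KalmanFilter.exists_eq_closedLoop_matrix E.τ E.posDef_Qo E.R_posDef hP hfix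
    (E.Qu b + E.coupling b * P * (KalmanFilter.closedLoop E.Ao E.Co E.R P)ᵀ)
  rw [add_assoc, ← hfixS] at hX
  refine ⟨P, X, KalmanFilter.gain E.Co E.R P, X * E.Coᵀ * (E.Co * P * E.Coᵀ + E.R)⁻¹,
    fun k₀ c h h0 => h.tendsto E h0 hP hfix hX, ⟨hP, by rw [← E.riccati_eq, hfix]⟩,
    fun P' hP' h => KalmanFilter.riccati_fixedPoint_unique E.posDef_Qo E.R_posDef hP hfix hP'
      ((E.riccati_eq P').trans h.symm), hX, fun Y hY => ?_, rfl, rfl,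
    fun k₀ u y c e h hPoo hPuo => ?_, fun k₀ u y e h => ?_, fun z hz =>
      KalmanFilter.norm_lt_one_of_mem_spectrum_closedLoop_kronecker E.τ E.posDef_Qo E.R_posDef
        hP hfix hz⟩
  · refine sub_eq_zero.1 (KalmanFilter.eq_zero_of_closedLoop_matrix E.τ E.posDef_Qo E.R_posDef
      hP hfix ?_)
    have e : Y - X = (E.Qu b + (E.A * Y + E.coupling b * P) * E.S P * E.Aoᵀ)
        - (E.Qu b + (E.A * X + E.coupling b * P) * E.S P * E.Aoᵀ) := by rw [← hX, ← hY]
    rw [hfixS, hfixS] at e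
    rw [add_sub_add_left_eq_sub, add_sub_add_left_eq_sub, ← Matrix.sub_mul, ← Matrix.mul_sub] at e
    exact e
  · have hc : ∀ k > k₀, c.PooPrior k = P ∧ c.PuoPrior k = X ∧
        c.Ho k = KalmanFilter.gain E.Co E.R P ∧
        c.Hu k = X * E.Coᵀ * (E.Co * P * E.Coᵀ + E.R)⁻¹ := fun k hk => by
      obtain ⟨h1, h2⟩ := h.cov.eq_of_stationary E hP hfix hX hPoo hPuo k hk
      exact ⟨h1, h2, by rw [h.cov.Ho_eq_gain hk, h1], by rw [h.cov.Hu_eq k hk, h1, h2]⟩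
    refine ⟨hc, h.est.oPrior_eq, h.est.uPrior_eq, fun k hk => ?_, fun k hk => ?_⟩
    · rw [h.est.oPost_eq k hk, (hc k hk).2.2.1]
    · rw [h.est.uPost_eq k hk, (hc k hk).2.2.2]
  -- The constant run has the posterior of `P` already at time `k₀`, so its first prior is `P`; its
  -- gains are constant, so the estimate equations are those of `h`.
  · exact ⟨E.stationaryCovariances P X, KalmanFilter.posSemidef_posterior E.R_posDef hP,
      ⟨E.covarianceEquations_stationaryCovariances hP hfix hX, h⟩, rfl, rfl⟩
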